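/- Let $f\colon X\times Y\to\{0,1\}$ with $|X|=|Y|=n$ be a random Boolean function with parameter $p=p(n)$, i.e. the $n^2$ values $f(x,y)$ are independent and each equals $1$ with probability $p$ and $0$ with probability $1-p$. Write $p = 1-\lambda/n$ with $\lambda=\lambda(n)$, and assume $p>\tfrac12$ (that is, $\lambda<n/2$). A 1-rectangle of $f$ is a set $A\times B\subseteq X\times Y$ with $A\times B\subseteq\operatorname{supp} f:=\{(x,y): f(x,y)=1\}$. The fractional cover number of $f$ is $$\chi^*(f):=\min_\pi \frac{1}{\gamma(\pi)},\qquad \gamma(\pi):=\min_{(x,y)\in\operatorname{supp} f}\ \Pr_{R\sim\pi}\bigl((x,y)\in R\bigr),$$ where $\pi$ ranges over all probability distributions on the set of 1-rectangles of $f$. All asymptotics are for $n\to\infty$; $g\ll h$ means $g=o(h)$; and "a.a.s." means with probability tending to $1$. (a) If $\ln n\ll\lambda<n/2$, then, a.a.s., $$(1-o(1))\,p\,e\,\lambda\ \le\ \chi^*(f)\ \le\ (1+o(1))\,e\,\lambda .$$ (b) If $\lambda=\Theta(\ln n)$, then, a.a.s., $\chi^*(f)=\Theta(\ln n)$; that is,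 there are constants $c,C>0$ such that, a.a.s., $c\ln n\le\chi^*(f)\le C\ln n$. (c) If $1\ll\lambda=o(\ln n)$, then, a.a.s., $$(1-o(1))\,\lambda\ \le\ \chi^*(f)\ \le\ (1+o(1))\,e\,\max\Bigl(2\lambda,\ \frac{\ln n}{\ln\bigl((\ln n)/\lambda\bigr)}\Bigr).$$ -/

import Mathlib

open Filter Topology MeasureTheory

open scoped ENNReal unitInterval Asymptotics

namespace BoolFun

/-- The support of a Boolean function `f : X × Y → {0,1}`: the set of its 1-entries. -/
def supp {X Y : Type*} (f : X × Y → Bool) : Set (X × Y) :=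
  {z | f z = true}

/-- `R` is a 1-rectangle of `f`: a cartesian product `A × B`, all of whose entries are 1-entries. -/
def IsOneRectangle {X Y : Type*} (f : X × Y → Bool) (R : Set (X × Y)) : Prop :=
  (∃ (A : Set X) (B : Set Y), R = A ×ˢ B) ∧ R ⊆ supp f

/-- The type of 1-rectangles of `f`. -/
abbrev OneRectangle {X Y : Type*} (f : X × Y → Bool) : Type _ :=
  {R : Set (X × Y) // IsOneRectangle f R}

/-- `coverProb f π` is the minimum, over the 1-entries `z` of `f`, of the probability that a random
1-rectangle `R` with distribution `π` contains `z`. (The minimum over an empty support is `∞`.) -/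
noncomputable def coverProb {X Y : Type*} (f : X × Y → Bool) (π : PMF (OneRectangle f)) : ℝ≥0∞ :=
  ⨅ z ∈ supp f, π.toOuterMeasure {R | z ∈ R.1}

/-- The fractional cover number of `f`: the minimum of `1 / coverProb f π` over all probability
distributions `π` on the set of 1-rectangles of `f`. Here `1 / 0 = ∞`, so that distributions which
miss a 1-entry do not contribute. -/
noncomputable def fracCoverNumber {X Y : Type*} (f : X × Y → Bool) : ℝ≥0∞ :=
  ⨅ π : PMF (OneRectangle f), 1 / coverProb f π

/-- The law of a random Boolean function on `[n] × [n]` with parameter `p`: its values are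
independent, each being 1 with probability `p` and 0 with probability `1 - p`. -/
noncomputable def randomBoolFun (n : ℕ) (p : I) : Measure (Fin n × Fin n → Bool) :=
  Measure.pi fun _ => ProbabilityTheory.bernoulliMeasure true false p

/-- The family of events `E n` holds asymptotically almost surely for the random Boolean function
on `[n] × [n]` with parameter `p n`. -/
def AAS (p : ℕ → I) (E : ∀ n : ℕ, (Fin n × Fin n → Bool) → Prop) : Prop :=
  Tendsto (fun n => randomBoolFun n (p n) {f | E n f}) atTop (𝓝 1)

end BoolFun

/-! Lower bound: by LP duality with uniform weights, the fractional cover number is at least |supp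
f| divided by the largest 1-rectangle. The support has about p n² elements. A set of a rows has on
average n p^a ≤ n e^(-aλ/n) common columns, and a·n·e^(-aλ/n) is at most n²/(eλ), attained at a =
n/λ. To make this uniform over all rectangles, `IsOneRectangle.exists_thin` reduces to at most √K +
1 rows or columns, where K is slightly above n²/(eλ). As λ → ∞ there are only e^(o(n)) such sets,
while each fails with probability at most e^(-κn) (`exists_tilt`).

Upper bound: pick each row independently with probability 1/(Z+1) and take all columns that are 1 on
the chosen rows. If no column has more than Z zeros, every 1-entry is covered with probability at
least 1/(e(Z+1)) (`fracCoverNumber_le`). A Chernoff bound and a union bound over the n columns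
control Z; the three regimes differ only in the threshold and the tilt.

Both bounds are proved for a fixed tolerance η; in (a) and (c), `exists_tendsto_zero_of_forall_pos`
turns η into o(1). -/

open Classical in
/-- A Chernoff bound for the number of events that occur, under a one-sided product hypothesis. -/
theorem measureReal_card_ge_le {Ω ι : Type*} [MeasurableSpace Ω] [Finite Ω]
    [MeasurableSingletonClass Ω] (μ : Measure Ω) [IsFiniteMeasure μ] (J : Finset ι)
    (E : ι → Set Ω) {q : ℝ} (hq : ∀ B ⊆ J, μ.real (⋂ j ∈ B, E j) ≤ q ^ B.card)
    (hq0 : 0 ≤ q) {θ : ℝ} (hθ : 1 ≤ θ) (b : ℝ) :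
    μ.real {ω | b ≤ ((J.filter (fun j => ω ∈ E j)).card : ℝ)} ≤
      Real.exp (J.card * (q * (θ - 1)) - b * Real.log θ) := by
  have hθ0 : 0 < θ := by linarith
  -- `F` is θ to the number of occurring events. Expanded over subsets its coefficients are
  -- nonnegative because θ ≥ 1, so upper bounds on joint probabilities suffice and independence is
  -- not needed.
  set F : Ω → ℝ := fun ω => ∏ j ∈ J, (1 + (θ - 1) * (E j).indicator 1 ω) with hF
  have hFpow : ∀ ω, F ω = θ ^ (J.filter (fun j => ω ∈ E j)).card := by
    intro ω
    rw [hF, Finset.card_filter, ← Finset.prod_pow_eq_pow_sum]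
    refine Finset.prod_congr rfl fun j _ => ?_
    by_cases h : ω ∈ E j <;> simp [h]
  have hFexp : ∀ ω, F ω = ∑ B ∈ J.powerset, (θ - 1) ^ B.card * (⋂ j ∈ B, E j).indicator 1 ω := by
    intro ω
    rw [hF]
    simp only
    rw [Finset.prod_one_add]
    refine Finset.sum_congr rfl fun B _ => ?_
    rw [Finset.prod_mul_distrib, Finset.prod_const]
    congr 1
    by_cases h : ω ∈ ⋂ j ∈ B, E j
    · rw [Set.indicator_of_mem h]
      refine Finset.prod_eq_one fun j hj => ?_
      rw [Set.indicator_of_mem (Set.mem_iInter₂.1 h j hj)]; rfl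
    · rw [Set.indicator_of_notMem h]
      simp only [Set.mem_iInter, not_forall] at h
      obtain ⟨j, hj, h⟩ := h
      exact Finset.prod_eq_zero hj (Set.indicator_of_notMem h _)
  have hint : ∫ ω, F ω ∂μ ≤ Real.exp (J.card * (q * (θ - 1))) := by
    simp_rw [hFexp]
    rw [integral_finsetSum _ fun _ _ => Integrable.of_finite]
    calc ∑ B ∈ J.powerset, ∫ ω, (θ - 1) ^ B.card * (⋂ j ∈ B, E j).indicator 1 ω ∂μ
        ≤ ∑ B ∈ J.powerset, ∏ j ∈ B, (q * (θ - 1)) := by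
          refine Finset.sum_le_sum fun B hB => ?_
          rw [integral_const_mul, integral_indicator_one (Set.toFinite _).measurableSet,
            Finset.prod_const, mul_pow, mul_comm]
          exact mul_le_mul_of_nonneg_right (hq B (Finset.mem_powerset.1 hB))
            (pow_nonneg (by linarith) _)
      _ = (1 + q * (θ - 1)) ^ J.card := by
          rw [← Finset.prod_one_add, Finset.prod_const]
      _ ≤ Real.exp (q * (θ - 1)) ^ J.card := by
          have := mul_nonneg hq0 (sub_nonneg.2 hθ)
          refine pow_le_pow_left₀ (by positivity) ?_ _
          linarith [Real.add_one_le_exp (q * (θ - 1))]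
      _ = _ := by rw [← Real.exp_nat_mul]
  have hmarkov := mul_meas_ge_le_integral_of_nonneg (μ := μ) (f := F)
    (ae_of_all _ fun ω => by rw [hFpow]; positivity) Integrable.of_finite
    (Real.exp (b * Real.log θ))
  have hset : {ω | b ≤ ((J.filter (fun j => ω ∈ E j)).card : ℝ)} ⊆
      {ω | Real.exp (b * Real.log θ) ≤ F ω} := by
    intro ω hω
    simp only [Set.mem_ofPred_eq] at hω ⊢
    rw [hFpow, ← Real.rpow_natCast, Real.rpow_def_of_pos hθ0, mul_comm b]
    exact Real.exp_le_exp.2 (mul_le_mul_of_nonneg_left hω (Real.log_nonneg hθ))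
  rw [Real.exp_sub, le_div_iff₀ (Real.exp_pos _), mul_comm]
  exact (mul_le_mul_of_nonneg_left (measureReal_mono hset) (Real.exp_pos _).le).trans
    (hmarkov.trans hint)

/-- If `P n η`, antitone in the tolerance `η`, tends to `0` for each fixed `η > 0`, then one may
let the tolerance tend to `0` with `n`. -/
theorem exists_tendsto_zero_of_forall_pos {P : ℕ → ℝ → ℝ}
    (hmono : ∀ᶠ n in atTop, ∀ η η', 0 < η → η ≤ η' → P n η' ≤ P n η)
    (hnonneg : ∀ n η, 0 ≤ P n η)
    (hlim : ∀ η > 0, Tendsto (fun n => P n η) atTop (𝓝 0)) :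
    ∃ ε : ℕ → ℝ, Tendsto ε atTop (𝓝 0) ∧ Tendsto (fun n => P n (ε n)) atTop (𝓝 0) := by
  set S : ℕ → Set ℝ := fun n => {η | 0 < η ∧ P n η ≤ η} with hS
  have hbdd : ∀ n, BddBelow (S n) := fun n => ⟨0, fun η hη => hη.1.le⟩
  have hmem : ∀ η > 0, ∀ᶠ n in atTop, η ∈ S n := fun η hη =>
    ((hlim η hη).eventually (eventually_le_nhds hη)).mono fun n hn => ⟨hη, hn⟩
  -- The extra 1/(n+1) puts `ε n` strictly above some admissible tolerance even if the infimum is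
  -- not attained.
  set ε : ℕ → ℝ := fun n => sInf (S n) + 1 / ((n : ℝ) + 1) with hε
  have hε0 : Tendsto ε atTop (𝓝 0) := by
    have h1 : Tendsto (fun n => sInf (S n)) atTop (𝓝 0) := by
      refine tendsto_order.2 ⟨fun a ha => Eventually.of_forall fun n => ?_, fun a ha => ?_⟩
      · exact ha.trans_le (Real.sInf_nonneg fun η hη => hη.1.le)
      · filter_upwards [hmem (a / 2) (half_pos ha)] with n hn
        exact (csInf_le (hbdd n) hn).trans_lt (half_lt_self ha)
    have h2 := h1.add (tendsto_one_div_add_atTop_nhds_zero_nat (𝕜 := ℝ))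
    rwa [add_zero] at h2
  refine ⟨ε, hε0, squeeze_zero' (Eventually.of_forall fun n => hnonneg _ _) ?_ hε0⟩
  filter_upwards [hmem 1 one_pos, hmono] with n hn hmono
  have hlt : sInf (S n) < ε n := by
    have : (0 : ℝ) < 1 / ((n : ℝ) + 1) := by positivity
    simp only [hε]; linarith
  obtain ⟨η, hη, hηε⟩ := exists_lt_of_csInf_lt ⟨1, hn⟩ hlt
  exact (hmono η (ε n) hη.1 hηε.le).trans (hη.2.trans hηε.le)

namespace BoolFun

instance (n : ℕ) (p : I) : IsProbabilityMeasure (randomBoolFun n p) := by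
  unfold randomBoolFun; infer_instance

theorem randomBoolFun_real_forall_eq (n : ℕ) (p : I) (S : Finset (Fin n × Fin n)) (v : Bool) :
    (randomBoolFun n p).real {f | ∀ z ∈ S, f z = v} =
      (if v then (p : ℝ) else 1 - p) ^ S.card := by
  classical
  have : {f : Fin n × Fin n → Bool | ∀ z ∈ S, f z = v} =
      Set.univ.pi fun z => if z ∈ S then {v} else Set.univ := by
    ext f
    simp only [Set.mem_ofPred_eq, Set.mem_univ_pi]
    refine forall_congr' fun z => ?_
    by_cases h : z ∈ S <;> simp [h]
  rw [this, randomBoolFun, measureReal_def, Measure.pi_pi, ENNReal.toReal_prod]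
  have h : ∀ z : Fin n × Fin n, ((ProbabilityTheory.bernoulliMeasure true false p)
      (if z ∈ S then {v} else Set.univ)).toReal =
        if z ∈ S then (if v then (p : ℝ) else 1 - p) else 1 := by
    intro z
    by_cases hz : z ∈ S
    · rw [if_pos hz, if_pos hz, ← measureReal_def,
        ProbabilityTheory.bernoulliMeasure_real_apply _ (Set.toFinite _).measurableSet]
      cases v <;> simp
    · simp [hz]
  simp_rw [h]
  rw [Finset.prod_ite_mem, Finset.univ_inter, Finset.prod_const]

theorem aas_of_tendsto_zero {p : ℕ → I} {E : ∀ n : ℕ, (Fin n × Fin n → Bool) → Prop}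
    (h : Tendsto (fun n => (randomBoolFun n (p n)).real {f | ¬ E n f}) atTop (𝓝 0)) :
    AAS p E := by
  have h1 : Tendsto (fun n => 1 - (randomBoolFun n (p n)).real {f | ¬ E n f}) atTop (𝓝 1) := by
    simpa using h.const_sub 1
  have h2 := (ENNReal.tendsto_ofReal h1)
  rw [ENNReal.ofReal_one] at h2
  refine h2.congr fun n => ?_
  have : {f | ¬ E n f} = {f | E n f}ᶜ := rfl
  rw [this, probReal_compl_eq_one_sub (Set.toFinite _).measurableSet, sub_sub_cancel,
    measureReal_def, ENNReal.ofReal_toReal (measure_ne_top _ _)]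

/-! ### Deterministic bounds on the fractional cover number -/

/-- The dual bound on the fractional cover number, with the uniform weight on the support. -/
theorem ofReal_ncard_div_le_fracCoverNumber {X Y : Type*} [Finite X] [Finite Y]
    (f : X × Y → Bool) {M : ℝ} (hM : 0 < M)
    (h : ∀ R, IsOneRectangle f R → (R.ncard : ℝ) ≤ M) :
    ENNReal.ofReal ((supp f).ncard / M) ≤ fracCoverNumber f := by
  classical
  have := Fintype.ofFinite X
  have := Fintype.ofFinite Y
  refine le_iInf fun π => ?_
  -- Double counting: the cover probabilities summed over the support give the expected size of the
  -- random rectangle.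
  have key : ((supp f).ncard : ℝ≥0∞) * coverProb f π ≤ ENNReal.ofReal M := by
    calc ((supp f).ncard : ℝ≥0∞) * coverProb f π
        = ∑ z ∈ (supp f).toFinset, coverProb f π := by
          rw [Finset.sum_const, nsmul_eq_mul, Set.ncard_eq_toFinset_card']
      _ ≤ ∑ z ∈ (supp f).toFinset, π.toOuterMeasure {R | z ∈ R.1} :=
          Finset.sum_le_sum fun z hz => iInf₂_le z (Set.mem_toFinset.1 hz)
      _ = ∑ z ∈ (supp f).toFinset, ∑' R, π R * (if z ∈ R.1 then 1 else 0) := by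
          refine Finset.sum_congr rfl fun z _ => ?_
          rw [PMF.toOuterMeasure_apply]
          refine tsum_congr fun R => ?_
          by_cases hz : z ∈ R.1 <;> simp [Set.indicator, hz]
      _ = ∑' R, ∑ z ∈ (supp f).toFinset, π R * (if z ∈ R.1 then 1 else 0) := by
          rw [Summable.tsum_finsetSum fun _ _ => ENNReal.summable]
      _ ≤ ∑' R, π R * ENNReal.ofReal M := by
          refine ENNReal.tsum_le_tsum fun R => ?_
          rw [← Finset.mul_sum]
          gcongr
          rw [Finset.sum_boole, ← ENNReal.ofReal_natCast]
          refine ENNReal.ofReal_le_ofReal ((Nat.cast_le.2 ?_).trans (h R.1 R.2))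
          rw [Set.ncard_eq_toFinset_card']
          exact Finset.card_le_card fun z hz => by simpa using (Finset.mem_filter.1 hz).2
      _ = ENNReal.ofReal M := by rw [ENNReal.tsum_mul_right, PMF.tsum_coe, one_mul]
  have hM0 : ENNReal.ofReal M ≠ 0 := by simpa using hM
  rw [ENNReal.ofReal_div_of_pos hM, ENNReal.ofReal_natCast]
  refine ENNReal.div_le_of_le_mul ?_
  rcases eq_or_ne ((supp f).ncard : ℝ≥0∞) 0 with h0 | h0
  · simp [h0]
  have hfin : coverProb f π ≠ ∞ := by
    rintro hc
    rw [hc, ENNReal.mul_top h0] at key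
    exact ENNReal.ofReal_ne_top (top_le_iff.1 key)
  rcases eq_or_ne (coverProb f π) 0 with hc | hc
  · rw [hc, ENNReal.div_zero one_ne_zero, ENNReal.top_mul hM0]; exact le_top
  · rw [mul_comm, ← mul_div_assoc, mul_one]
    exact (ENNReal.le_div_iff_mul_le (Or.inl hc) (Or.inl hfin)).2 key

/-- The rectangle spanned by a set `A` of rows and all the columns that are constantly `1` on it. -/
def rowRectangle {X Y : Type*} (f : X × Y → Bool) (A : Finset X) : OneRectangle f :=
  ⟨(A : Set X) ×ˢ {y | ∀ x ∈ A, f (x, y) = true}, ⟨_, _, rfl⟩, fun z hz => hz.2 z.1 hz.1⟩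

-- The row rectangle of a random set contains (x, y) exactly when x is chosen and no row with a zero
-- in column y is. This has probability q(1-q)^W, with W the number of zeros in the column.
open Classical in
theorem fracCoverNumber_le {X Y : Type*} [Fintype X] (f : X × Y → Bool) (Z : ℕ)
    (h : ∀ y, (Finset.univ.filter fun x => f (x, y) = false).card ≤ Z) :
    fracCoverNumber f ≤ ENNReal.ofReal (Real.exp 1 * (Z + 1)) := by
  -- The maximizer of q(1-q)^Z.
  set q : ℝ := 1 / ((Z : ℝ) + 1) with hq
  have hq0 : 0 < q := by positivity
  have hq1 : q ≤ 1 := by rw [hq, div_le_one (by positivity)]; simp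
  set w : Finset X → ℝ := fun A => q ^ A.card * (1 - q) ^ (Fintype.card X - A.card) with hw
  have hw0 : ∀ A, 0 ≤ w A := fun A => by have := sub_nonneg.2 hq1; positivity
  have hsum : ∑ A, ENNReal.ofReal (w A) = 1 := by
    rw [← ENNReal.ofReal_sum_of_nonneg fun A _ => hw0 A, hw, Fintype.sum_pow_mul_eq_add_pow]
    simp
  set ν : PMF (Finset X) := PMF.ofFintype (fun A => ENNReal.ofReal (w A)) hsum with hν
  refine (iInf_le _ (ν.map (rowRectangle f))).trans ?_
  rw [one_div, ENNReal.inv_le_iff_inv_le, ← ENNReal.ofReal_inv_of_pos (by positivity)]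
  refine le_iInf₂ fun z hz => ?_
  obtain ⟨x, y⟩ := z
  rw [PMF.toOuterMeasure_map_apply, PMF.toOuterMeasure_apply_fintype]
  set W := Finset.univ.filter fun x => f (x, y) = false with hW
  have hxW : x ∉ W := by
    have : f (x, y) = true := hz
    simp [hW, this]
  -- Written with one factor per row, the event can be summed over all A by expanding a product of
  -- binomials.
  have hval : ∀ A : Finset X, (rowRectangle f ⁻¹' {R | (x, y) ∈ R.1}).indicator ν A =
      ENNReal.ofReal ((∏ i ∈ A, if i ∈ W then 0 else q) *
        ∏ i ∈ Finset.univ \ A, if i = x then 0 else (1 - q)) := by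
    intro A
    have hiff : A ∈ rowRectangle f ⁻¹' {R | (x, y) ∈ R.1} ↔ x ∈ A ∧ ∀ i ∈ A, i ∉ W := by
      simp [rowRectangle, hW]
    by_cases hA : x ∈ A ∧ ∀ i ∈ A, i ∉ W
    · rw [Set.indicator_of_mem (hiff.2 hA), hν, PMF.ofFintype_apply, hw,
        Finset.prod_congr rfl (g := fun _ => q) fun i hi => if_neg (hA.2 i hi),
        Finset.prod_congr rfl (g := fun _ => 1 - q) fun i hi => if_neg ?_]
      · simp [Finset.prod_const, Finset.card_sdiff]
      · rintro rfl; exact (Finset.mem_sdiff.1 hi).2 hA.1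
    · rw [Set.indicator_of_notMem (hiff.not.2 hA)]
      symm
      rw [ENNReal.ofReal_eq_zero]
      refine le_of_eq ?_
      rw [not_and_or] at hA
      rcases hA with hA | hA
      · exact mul_eq_zero_of_right _ (Finset.prod_eq_zero (i := x) (by simp [hA]) (by simp))
      · push Not at hA
        obtain ⟨i, hi, hiW⟩ := hA
        exact mul_eq_zero_of_left (Finset.prod_eq_zero hi (by simp [hiW])) _
  simp_rw [hval]
  rw [← ENNReal.ofReal_sum_of_nonneg fun A _ => ?_]
  swap
  · have := sub_nonneg.2 hq1
    refine mul_nonneg (Finset.prod_nonneg fun i _ => ?_) (Finset.prod_nonneg fun i _ => ?_) <;>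
      split_ifs <;> first | exact le_rfl | assumption | exact hq0.le
  refine ENNReal.ofReal_le_ofReal ?_
  rw [← Finset.powerset_univ, ← Finset.prod_add]
  have hprod : ∏ i, ((if i ∈ W then 0 else q) + if i = x then 0 else (1 - q)) =
      q * (1 - q) ^ W.card := by
    rw [← Finset.prod_const, ← Finset.mul_prod_erase _ _ (Finset.mem_univ x)]
    congr 1
    · simp [hxW]
    · rw [← Finset.prod_subset (s₁ := W) (s₂ := Finset.univ.erase x)]
      · refine Finset.prod_congr rfl fun i hi => ?_
        have : i ≠ x := fun h => hxW (h ▸ hi)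
        simp [hi, this]
      · intro i hi
        exact Finset.mem_erase.2 ⟨fun h => hxW (h ▸ hi), Finset.mem_univ _⟩
      · intro i hi hiW
        simp [hiW, (Finset.mem_erase.1 hi).1]
  rw [hprod]
  have h1 : (1 - q) ^ Z ≤ (1 - q) ^ W.card :=
    pow_le_pow_of_le_one (sub_nonneg.2 hq1) (by linarith) (h y)
  have h2 : Real.exp (-1) ≤ (1 - q) ^ Z := by
    rcases Nat.eq_zero_or_pos Z with rfl | hZ
    · simp
    have hZ' : (0 : ℝ) < Z := Nat.cast_pos.2 hZ
    have h3 : 1 - q = (1 + 1 / (Z : ℝ))⁻¹ := by rw [hq]; field_simp; ring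
    rw [h3, inv_pow, Real.exp_neg]
    refine inv_anti₀ (by positivity) ?_
    calc (1 + 1 / (Z : ℝ)) ^ Z ≤ Real.exp (1 / Z) ^ Z := by
          gcongr; linarith [Real.add_one_le_exp (1 / (Z : ℝ))]
      _ = Real.exp 1 := by rw [← Real.exp_nat_mul]; congr 1; field_simp
  calc (Real.exp 1 * ((Z : ℝ) + 1))⁻¹ = q * Real.exp (-1) := by
        rw [hq, Real.exp_neg]; field_simp
    _ ≤ _ := by gcongr; exact h2.trans h1

open Classical in
/-- The columns that are constantly `1` on the set `A` of rows. -/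
noncomputable def commonColumns {X Y : Type*} [Fintype Y] (f : X × Y → Bool) (A : Finset X) :
    Finset Y :=
  Finset.univ.filter fun y => ∀ x ∈ A, f (x, y) = true

open Classical in
/-- The rows that are constantly `1` on the set `B` of columns. -/
noncomputable def commonRows {X Y : Type*} [Fintype X] (f : X × Y → Bool) (B : Finset Y) :
    Finset X :=
  Finset.univ.filter fun x => ∀ y ∈ B, f (x, y) = true

theorem mem_commonColumns {X Y : Type*} [Fintype Y] {f : X × Y → Bool} {A : Finset X} {y : Y} :
    y ∈ commonColumns f A ↔ ∀ x ∈ A, f (x, y) = true := by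
  simp [commonColumns]

theorem mem_commonRows {X Y : Type*} [Fintype X] {f : X × Y → Bool} {B : Finset Y} {x : X} :
    x ∈ commonRows f B ↔ ∀ y ∈ B, f (x, y) = true := by
  simp [commonRows]

/-! ### Chernoff bounds for zeros and for common rows and columns -/

section Tails

variable (n : ℕ) (p : I)

theorem measureReal_column_zeros_ge {θ : ℝ} (hθ : 1 ≤ θ) (z : ℝ) :
    (randomBoolFun n p).real {f | ∃ y, z ≤ ((Finset.univ.filter fun x => f (x, y) = false).card : ℝ)}
      ≤ n * Real.exp (n * ((1 - p) * (θ - 1)) - z * Real.log θ) := by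
  classical
  have hcol : ∀ y : Fin n, (randomBoolFun n p).real
      {f | z ≤ ((Finset.univ.filter fun x => f (x, y) = false).card : ℝ)} ≤
        Real.exp (n * ((1 - p) * (θ - 1)) - z * Real.log θ) := by
    intro y
    have h := measureReal_card_ge_le (randomBoolFun n p) (Finset.univ : Finset (Fin n))
      (fun x => {f | f (x, y) = false}) (q := 1 - p) (fun B _ => ?_)
      (sub_nonneg.2 p.2.2) hθ z
    · rw [Finset.card_univ, Fintype.card_fin] at h
      convert h using 8
      exact Iff.rfl
    · have := randomBoolFun_real_forall_eq n p (B ×ˢ {y}) false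
      rw [Finset.card_product, Finset.card_singleton, mul_one] at this
      refine le_of_eq (Eq.trans ?_ this)
      congr 1
      ext f
      simp
  have hset : {f : Fin n × Fin n → Bool |
      ∃ y, z ≤ ((Finset.univ.filter fun x => f (x, y) = false).card : ℝ)} =
      ⋃ y ∈ (Finset.univ : Finset (Fin n)),
        {f | z ≤ ((Finset.univ.filter fun x => f (x, y) = false).card : ℝ)} := by
    ext f; simp
  rw [hset]
  refine (measureReal_biUnion_finset_le _ _).trans ((Finset.sum_le_sum fun y _ => hcol y).trans ?_)
  simp

theorem measureReal_zeros_ge {θ : ℝ} (hθ : 1 ≤ θ) (z : ℝ) :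
    (randomBoolFun n p).real {f | z ≤ ((Finset.univ.filter fun w => f w = false).card : ℝ)}
      ≤ Real.exp ((n : ℝ) ^ 2 * ((1 - p) * (θ - 1)) - z * Real.log θ) := by
  classical
  have h := measureReal_card_ge_le (randomBoolFun n p) (Finset.univ : Finset (Fin n × Fin n))
    (fun w => {f | f w = false}) (q := 1 - p) (fun B _ => ?_) (sub_nonneg.2 p.2.2) hθ z
  · rw [Finset.card_univ, Fintype.card_prod, Fintype.card_fin, Nat.cast_mul, ← sq] at h
    convert h using 8
    exact Iff.rfl
  · have := randomBoolFun_real_forall_eq n p B false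
    refine le_of_eq (Eq.trans ?_ this)
    congr 1
    ext f
    simp

theorem measureReal_common_columns_ge (A : Finset (Fin n)) {θ : ℝ} (hθ : 1 ≤ θ) (b : ℝ) :
    (randomBoolFun n p).real
        {f | b ≤ ((commonColumns f A).card : ℝ)}
      ≤ Real.exp (n * ((p : ℝ) ^ A.card * (θ - 1)) - b * Real.log θ) := by
  classical
  have h := measureReal_card_ge_le (randomBoolFun n p) (Finset.univ : Finset (Fin n))
    (fun y => {f | ∀ x ∈ A, f (x, y) = true}) (q := (p : ℝ) ^ A.card) (fun B _ => ?_)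
    (pow_nonneg p.2.1 _) hθ b
  · rw [Finset.card_univ, Fintype.card_fin] at h
    convert h using 8
    exact (Finset.ext fun y => by simp [mem_commonColumns])
  · have := randomBoolFun_real_forall_eq n p (A ×ˢ B) true
    rw [Finset.card_product, pow_mul] at this
    refine le_of_eq (Eq.trans ?_ this)
    congr 1
    ext f
    simp only [Set.mem_iInter, Set.mem_ofPred_eq, Finset.mem_product, Prod.forall]
    exact ⟨fun h x y hxy => h y hxy.2 x hxy.1, fun h y hy x hx => h x y ⟨hx, hy⟩⟩

theorem measureReal_common_rows_ge (B : Finset (Fin n)) {θ : ℝ} (hθ : 1 ≤ θ) (b : ℝ) :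
    (randomBoolFun n p).real
        {f | b ≤ ((commonRows f B).card : ℝ)}
      ≤ Real.exp (n * ((p : ℝ) ^ B.card * (θ - 1)) - b * Real.log θ) := by
  classical
  have h := measureReal_card_ge_le (randomBoolFun n p) (Finset.univ : Finset (Fin n))
    (fun x => {f | ∀ y ∈ B, f (x, y) = true}) (q := (p : ℝ) ^ B.card) (fun A _ => ?_)
    (pow_nonneg p.2.1 _) hθ b
  · rw [Finset.card_univ, Fintype.card_fin] at h
    convert h using 8
    exact (Finset.ext fun y => by simp [mem_commonRows])
  · have := randomBoolFun_real_forall_eq n p (A ×ˢ B) true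
    rw [Finset.card_product, mul_comm, pow_mul] at this
    refine le_of_eq (Eq.trans ?_ this)
    congr 1
    ext f
    simp only [Set.mem_iInter, Set.mem_ofPred_eq, Finset.mem_product, Prod.forall]
    exact ⟨fun h x y hxy => h x hxy.1 y hxy.2, fun h x hx y hy => h x y ⟨hx, hy⟩⟩

end Tails

/-! ### The size of the largest 1-rectangle -/

/-- Each counted set has weight x^|A| ≥ x^s in the binomial expansion of (1+x)^n ≤ e^(nx). -/
theorem card_filter_card_le (n : ℕ) {x s : ℝ} (hx0 : 0 < x) (hx1 : x ≤ 1) :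
    ((Finset.univ.filter fun A : Finset (Fin n) => (A.card : ℝ) ≤ s).card : ℝ) ≤
      Real.exp (n * x - s * Real.log x) := by
  have h1 : ((Finset.univ.filter fun A : Finset (Fin n) => (A.card : ℝ) ≤ s).card : ℝ) *
      x ^ s ≤ (x + 1) ^ n := by
    calc _ = ∑ A ∈ Finset.univ.filter (fun A : Finset (Fin n) => (A.card : ℝ) ≤ s), x ^ s := by
          rw [Finset.sum_const, nsmul_eq_mul]
      _ ≤ ∑ A ∈ Finset.univ.filter (fun A : Finset (Fin n) => (A.card : ℝ) ≤ s),
          x ^ A.card * 1 ^ (n - A.card) := by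
          refine Finset.sum_le_sum fun A hA => ?_
          rw [one_pow, mul_one, ← Real.rpow_natCast]
          exact Real.rpow_le_rpow_of_exponent_ge hx0 hx1 (Finset.mem_filter.1 hA).2
      _ ≤ ∑ A : Finset (Fin n), x ^ A.card * 1 ^ (n - A.card) :=
          Finset.sum_le_sum_of_subset_of_nonneg (Finset.filter_subset _ _)
            fun A _ _ => by positivity
      _ = (x + 1) ^ n := Fin.sum_pow_mul_eq_add_pow x 1
  have h2 : (x + 1) ^ n ≤ Real.exp (n * x) := by
    rw [Real.exp_nat_mul]
    exact pow_le_pow_left₀ (by positivity) (Real.add_one_le_exp x) n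
  rw [Real.exp_sub, le_div_iff₀ (Real.exp_pos _), mul_comm s, ← Real.rpow_def_of_pos hx0]
  exact h1.trans h2

/-- A large rectangle contains an equally large one that has few rows or few columns. -/
theorem IsOneRectangle.exists_thin {X Y : Type*} [Fintype X] [Fintype Y]
    {f : X × Y → Bool} {R : Set (X × Y)} (hR : IsOneRectangle f R) {K : ℝ} (hK : 0 < K)
    (hKR : K < R.ncard) :
    (∃ A : Finset X, 0 < A.card ∧ (A.card : ℝ) ≤ √K + 1 ∧
      K / A.card ≤ ((commonColumns f A).card : ℝ)) ∨
    ∃ B : Finset Y, 0 < B.card ∧ (B.card : ℝ) ≤ √K + 1 ∧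
      K / B.card ≤ ((commonRows f B).card : ℝ) := by
  classical
  obtain ⟨⟨A', B', rfl⟩, hsub⟩ := hR
  obtain ⟨A, rfl⟩ : ∃ A : Finset X, (A : Set X) = A' := ⟨A'.toFinset, by simp⟩
  obtain ⟨B, rfl⟩ : ∃ B : Finset Y, (B : Set Y) = B' := ⟨B'.toFinset, by simp⟩
  have hone : ∀ x ∈ A, ∀ y ∈ B, f (x, y) = true := fun x hx y hy => hsub ⟨hx, hy⟩
  rw [Set.ncard_prod, Set.ncard_coe_finset, Set.ncard_coe_finset, Nat.cast_mul] at hKR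
  have hcols : ∀ A₁ ⊆ A, (B.card : ℝ) ≤
      ((commonColumns f A₁).card : ℝ) := fun A₁ h =>
    Nat.cast_le.2 (Finset.card_le_card fun y hy =>
      mem_commonColumns.2 fun x hx => hone x (h hx) y hy)
  have hrows : (A.card : ℝ) ≤
      ((commonRows f B).card : ℝ) :=
    Nat.cast_le.2 (Finset.card_le_card fun x hx => mem_commonRows.2 (hone x hx))
  have hA0 : (0 : ℝ) < A.card := by
    by_contra h
    have : (A.card : ℝ) = 0 := le_antisymm (not_lt.1 h) (Nat.cast_nonneg _)
    rw [this, zero_mul] at hKR; linarith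
  have hB0 : (0 : ℝ) < B.card := by
    by_contra h
    have : (B.card : ℝ) = 0 := le_antisymm (not_lt.1 h) (Nat.cast_nonneg _)
    rw [this, mul_zero] at hKR; linarith
  by_cases hA : (A.card : ℝ) ≤ √K + 1
  · refine Or.inl ⟨A, Nat.cast_pos.1 hA0, hA, ?_⟩
    rw [div_le_iff₀ hA0]
    nlinarith [hcols A subset_rfl]
  by_cases hB : (B.card : ℝ) ≤ √K + 1
  · refine Or.inr ⟨B, Nat.cast_pos.1 hB0, hB, ?_⟩
    rw [div_le_iff₀ hB0]
    nlinarith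
  -- Both sides are now longer than √K + 1: keep only ⌈√K⌉ rows, and the more than √K columns still
  -- give area at least K.
  push Not at hA hB
  have hs : 0 < √K := Real.sqrt_pos.2 hK
  obtain ⟨A₁, hA₁, hcard⟩ := Finset.exists_subset_card_eq (s := A) (n := ⌈√K⌉₊)
    (by exact_mod_cast ((Nat.ceil_lt_add_one hs.le).trans hA).le)
  have h1 : √K ≤ A₁.card := by rw [hcard]; exact Nat.le_ceil _
  refine Or.inl ⟨A₁, by rw [hcard]; exact Nat.ceil_pos.2 hs, ?_, ?_⟩
  · rw [hcard]; exact (Nat.ceil_lt_add_one hs.le).le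
  · rw [div_le_iff₀ (hs.trans_le h1)]
    have h2 := hcols A₁ hA₁
    have h3 := Real.mul_self_sqrt hK.le
    have h4 : √K ≤ ((commonColumns f A₁).card : ℝ) := by linarith
    calc K = √K * √K := h3.symm
      _ ≤ _ := mul_le_mul h4 h1 hs.le (by positivity)

theorem one_add_mul_log_pos {ε : ℝ} (hε : 0 < ε) : 0 < (1 + ε) * Real.log (1 + ε) - ε := by
  have h := Real.log_lt_sub_one_of_pos (x := (1 + ε)⁻¹) (by positivity) (by
    intro h; rw [inv_eq_one] at h; linarith)
  rw [Real.log_inv] at h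
  have h2 : (1 + ε) * ((1 + ε)⁻¹ - 1) = -ε := by field_simp; ring
  nlinarith

/-- The exponent in the first moment bound for rectangles, optimized over the tilt `θ`. -/
theorem exists_tilt {ε : ℝ} (hε : 0 < ε) :
    ∃ κ > 0, ∀ t > 0, ∀ q ≤ Real.exp (-t), ∃ θ ≥ 1,
      q * (θ - 1) - (1 + ε) / (Real.exp 1 * t) * Real.log θ ≤ -κ := by
  have hc := one_add_mul_log_pos hε
  set c := (1 + ε) * Real.log (1 + ε) - ε with hcdef
  have he := Real.exp_pos 1
  have he1 := Real.exp_one_lt_d9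
  refine ⟨min (c / (Real.exp 1 * 6)) (1 / 10), lt_min (by positivity) (by norm_num),
    fun t ht q hq => ?_⟩
  -- For bounded t, the tilt 1 + ε and e^(-t) ≤ 1/(et) leave a gap c/(et), which degenerates as t
  -- grows. For t > 6 the tilt e^(t/2) makes the second term the constant (1+ε)/(2e) > 0.16, against
  -- at most e^(-3) < 0.06 from the first.
  by_cases h6 : t ≤ 6
  · refine ⟨1 + ε, by linarith, ?_⟩
    have hq' : q ≤ 1 / (Real.exp 1 * t) := by
      refine hq.trans ?_
      rw [Real.exp_neg, one_div]
      refine inv_anti₀ (by positivity) ?_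
      calc Real.exp 1 * t ≤ Real.exp 1 * Real.exp (t - 1) := by
            gcongr; linarith [Real.add_one_le_exp (t - 1)]
        _ = Real.exp t := by rw [← Real.exp_add]; congr 1; ring
    calc q * (1 + ε - 1) - (1 + ε) / (Real.exp 1 * t) * Real.log (1 + ε)
        ≤ 1 / (Real.exp 1 * t) * (1 + ε - 1) - (1 + ε) / (Real.exp 1 * t) * Real.log (1 + ε) := by
          gcongr; linarith
      _ = -(c / (Real.exp 1 * t)) := by rw [hcdef]; ring
      _ ≤ -(c / (Real.exp 1 * 6)) := by gcongr
      _ ≤ _ := neg_le_neg (min_le_left _ _)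
  · push Not at h6
    refine ⟨Real.exp (t / 2), Real.one_le_exp (by positivity), ?_⟩
    rw [Real.log_exp]
    have h1 : q * (Real.exp (t / 2) - 1) ≤ Real.exp (-3) := by
      calc q * (Real.exp (t / 2) - 1) ≤ Real.exp (-t) * (Real.exp (t / 2) - 1) := by
            gcongr
            linarith [Real.one_le_exp (show 0 ≤ t / 2 by positivity)]
        _ ≤ Real.exp (-t) * Real.exp (t / 2) := by
            gcongr; linarith
        _ = Real.exp (-t / 2) := by rw [← Real.exp_add]; congr 1; ring
        _ ≤ Real.exp (-3) := Real.exp_le_exp.2 (by linarith)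
    have h2 : (1 + ε) / (Real.exp 1 * t) * (t / 2) = (1 + ε) / (2 * Real.exp 1) := by
      field_simp
    have h3 : 0.16 ≤ (1 + ε) / (2 * Real.exp 1) := by
      rw [le_div_iff₀ (by positivity)]; nlinarith
    have h4 : Real.exp (-3) ≤ 0.06 := by
      have : (20 : ℝ) ≤ Real.exp 3 := by
        have h5 : Real.exp 3 = Real.exp 1 ^ 3 := by rw [← Real.exp_nat_mul]; norm_num
        rw [h5]
        calc (20 : ℝ) ≤ 2.718 ^ 3 := by norm_num
          _ ≤ _ := by gcongr; linarith [Real.exp_one_gt_d9]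
      rw [Real.exp_neg]
      calc (Real.exp 3)⁻¹ ≤ (20 : ℝ)⁻¹ := inv_anti₀ (by norm_num) this
        _ ≤ _ := by norm_num
    rw [h2]
    refine le_trans ?_ (neg_le_neg (min_le_right _ _))
    linarith

/-- With exponentially small failure probability, all 1-rectangles are essentially bounded by
`n ^ 2 / (e * lam)`, once `lam` is large. -/
theorem exists_measureReal_rectangle_le {ε : ℝ} (hε : 0 < ε) (hε1 : ε ≤ 1) :
    ∃ κ > 0, ∃ L : ℝ, ∀ (n : ℕ) (p : I) (lam : ℝ), 0 < n → L ≤ lam → lam ≤ n →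
      (p : ℝ) = 1 - lam / n →
        (randomBoolFun n p).real
          {f | ∃ R, IsOneRectangle f R ∧ (1 + ε) * n ^ 2 / (Real.exp 1 * lam) < R.ncard} ≤
            2 * Real.exp (-(κ * n)) := by
  classical
  obtain ⟨κ, hκ, htilt⟩ := exists_tilt hε
  -- The thin sets will number at most exp(n(1 + log λ)/√λ); L is chosen so that this costs only
  -- half of the exponent κ.
  have hlim : Tendsto (fun l : ℝ => (1 + Real.log l) / √l) atTop (𝓝 0) := by
    have h1 : Tendsto (fun l : ℝ => Real.log l / √l) atTop (𝓝 0) := by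
      have := (isLittleO_log_rpow_atTop (r := 1 / 2) (by norm_num)).tendsto_div_nhds_zero
      simpa [Real.sqrt_eq_rpow] using this
    have h2 : Tendsto (fun l : ℝ => 1 / √l) atTop (𝓝 0) :=
      Real.tendsto_sqrt_atTop.const_div_atTop 1
    simpa [add_div] using h2.add h1
  obtain ⟨L₀, hL₀⟩ := eventually_atTop.1 (hlim.eventually (eventually_le_nhds (half_pos hκ)))
  refine ⟨κ / 2, half_pos hκ, max L₀ 1, fun n p lam hn hL hlam hp => ?_⟩
  have hn1 : (1 : ℝ) ≤ n := Nat.one_le_cast.2 hn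
  have hn0 : (0 : ℝ) < n := by linarith
  have hl1 : 1 ≤ lam := (le_max_right _ _).trans hL
  have hl0 : 0 < lam := by linarith
  have hent := hL₀ lam ((le_max_left _ _).trans hL)
  have he := Real.exp_pos 1
  have he2 : (2 : ℝ) ≤ Real.exp 1 := by linarith [Real.exp_one_gt_d9]
  set K := (1 + ε) * (n : ℝ) ^ 2 / (Real.exp 1 * lam) with hK
  have hK0 : 0 < K := by positivity
  have hsl : 0 < √lam := Real.sqrt_pos.2 hl0
  have hs : √K + 1 ≤ 2 * n / √lam := by
    have h1 : √K ≤ n / √lam := by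
      refine Real.sqrt_le_iff.2 ⟨by positivity, ?_⟩
      rw [div_pow, Real.sq_sqrt hl0.le, hK, div_le_div_iff₀ (by positivity) hl0]
      have : (1 + ε) * ((n : ℝ) ^ 2 * lam) ≤ Real.exp 1 * ((n : ℝ) ^ 2 * lam) := by
        gcongr; linarith
      linarith
    have h2 : 1 ≤ n / √lam := by
      rw [le_div_iff₀ hsl, one_mul]
      calc √lam ≤ √((n : ℝ) ^ 2) := Real.sqrt_le_sqrt (by nlinarith)
        _ = n := Real.sqrt_sq hn0.le
    have : 2 * (n : ℝ) / √lam = n / √lam + n / √lam := by ring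
    linarith
  -- the tail bound for a fixed nonempty set of rows (or of columns)
  have htail : ∀ a : ℕ, 0 < a → ∃ θ ≥ 1,
      n * ((p : ℝ) ^ a * (θ - 1)) - K / a * Real.log θ ≤ -(κ * n) := by
    intro a ha
    have ha0 : (0 : ℝ) < a := Nat.cast_pos.2 ha
    -- With t = aλ/n, the threshold K/a is n(1+ε)/(et), so the tilt bound applies after scaling by
    -- n.
    obtain ⟨θ, hθ, h⟩ := htilt (a * (lam / n)) (by positivity) ((p : ℝ) ^ a) (by
      rw [← mul_neg, Real.exp_nat_mul]
      refine pow_le_pow_left₀ p.2.1 ?_ _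
      rw [hp]
      linarith [Real.add_one_le_exp (-(lam / n))])
    refine ⟨θ, hθ, ?_⟩
    have hKa : K / a = n * ((1 + ε) / (Real.exp 1 * (a * (lam / n)))) := by
      rw [hK]; field_simp
    rw [hKa]
    nlinarith [mul_le_mul_of_nonneg_left h hn0.le]
  set 𝒜 := Finset.univ.filter fun A : Finset (Fin n) => (A.card : ℝ) ≤ √K + 1 with h𝒜
  have hcount : (𝒜.card : ℝ) ≤ Real.exp (n * (κ / 2)) := by
    refine (card_filter_card_le n (x := (√lam)⁻¹) (by positivity)
      (inv_le_one_of_one_le₀ (Real.one_le_sqrt.2 hl1))).trans (Real.exp_le_exp.2 ?_)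
    rw [Real.log_inv, Real.log_sqrt hl0.le]
    have hlog : 0 ≤ Real.log lam := Real.log_nonneg hl1
    have h1 : (√K + 1) * (Real.log lam / 2) ≤ 2 * n / √lam * (Real.log lam / 2) := by gcongr
    calc (n : ℝ) * (√lam)⁻¹ - (√K + 1) * -(Real.log lam / 2)
        = n * (√lam)⁻¹ + (√K + 1) * (Real.log lam / 2) := by ring
      _ ≤ n * (√lam)⁻¹ + 2 * n / √lam * (Real.log lam / 2) := by linarith
      _ = n * ((1 + Real.log lam) / √lam) := by field_simp
      _ ≤ n * (κ / 2) := by gcongr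
  have hunion : ∀ E : Finset (Fin n) → Set (Fin n × Fin n → Bool),
      (∀ A : Finset (Fin n), 0 < A.card → (randomBoolFun n p).real (E A) ≤ Real.exp (-(κ * n))) →
      (randomBoolFun n p).real (⋃ A ∈ 𝒜.filter (fun A => 0 < A.card), E A) ≤
        Real.exp (-(κ / 2 * n)) := by
    intro E hE
    calc _ ≤ ∑ A ∈ 𝒜.filter (fun A => 0 < A.card), (randomBoolFun n p).real (E A) :=
          measureReal_biUnion_finset_le _ _
      _ ≤ ∑ A ∈ 𝒜.filter (fun A => 0 < A.card), Real.exp (-(κ * n)) :=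
          Finset.sum_le_sum fun A hA => hE A (Finset.mem_filter.1 hA).2
      _ = (𝒜.filter (fun A => 0 < A.card)).card * Real.exp (-(κ * n)) := by
          rw [Finset.sum_const, nsmul_eq_mul]
      _ ≤ 𝒜.card * Real.exp (-(κ * n)) := by
          gcongr; exact Finset.filter_subset _ _
      _ ≤ Real.exp (n * (κ / 2)) * Real.exp (-(κ * n)) := by gcongr
      _ = _ := by rw [← Real.exp_add]; congr 1; ring
  have hcols := hunion
    (fun A => {f | K / A.card ≤
      ((commonColumns f A).card : ℝ)}) (fun A hA => by
      obtain ⟨θ, hθ, h⟩ := htail A.card hA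
      exact (measureReal_common_columns_ge n p A hθ _).trans (Real.exp_le_exp.2 h))
  have hrows := hunion
    (fun B => {f | K / B.card ≤
      ((commonRows f B).card : ℝ)}) (fun A hA => by
      obtain ⟨θ, hθ, h⟩ := htail A.card hA
      exact (measureReal_common_rows_ge n p A hθ _).trans (Real.exp_le_exp.2 h))
  rw [two_mul]
  refine le_trans (measureReal_mono ?_) ((measureReal_union_le _ _).trans (add_le_add hcols hrows))
  rintro f ⟨R, hR, hKR⟩
  rcases hR.exists_thin hK0 hKR with ⟨A, h0, hA, h⟩ | ⟨A, h0, hA, h⟩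
  · exact Or.inl (Set.mem_iUnion₂.2 ⟨A, by simp [h𝒜, hA, Finset.card_pos.1 h0], h⟩)
  · exact Or.inr (Set.mem_iUnion₂.2 ⟨A, by simp [h𝒜, hA, Finset.card_pos.1 h0], h⟩)

/-- Tilt by 1 + δ and use log(1+δ) ≥ 2δ/(2+δ). The additive slack δn² is harmless for the lower
bound, since the support has order n² when p > 1/2. -/
theorem measureReal_zeros_ge_add (n : ℕ) (p : I) {lam δ : ℝ} (hn : 0 < n)
    (hp : (p : ℝ) = 1 - lam / n) (hlam : lam ≤ n / 2) (hδ : 0 < δ) (hδ1 : δ ≤ 1) :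
    (randomBoolFun n p).real
        {f | (lam + δ * n) * n ≤ ((Finset.univ.filter fun w => f w = false).card : ℝ)}
      ≤ Real.exp (-(δ ^ 2 / 2 * n)) := by
  have hn1 : (1 : ℝ) ≤ n := Nat.one_le_cast.2 hn
  have hn0 : (0 : ℝ) < n := by linarith
  refine (measureReal_zeros_ge n p (show 1 ≤ 1 + δ by linarith) _).trans (Real.exp_le_exp.2 ?_)
  have hlog := Real.le_log_one_add_of_nonneg hδ.le
  have hlam0 : 0 ≤ lam := by
    have h1 : (1 : ℝ) - lam / n ≤ 1 := hp ▸ p.2.2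
    have h2 : 0 ≤ lam / n := by linarith
    rwa [le_div_iff₀ hn0, zero_mul] at h2
  have h1 : (n : ℝ) ^ 2 * ((1 - p) * (1 + δ - 1)) = lam * n * δ := by
    rw [hp]; field_simp; ring
  rw [h1]
  have h2 : (lam + δ * n) * n * (2 * δ / (δ + 2)) ≤ (lam + δ * n) * n * Real.log (1 + δ) := by
    gcongr
  have h3 : lam * n * δ - (lam + δ * n) * n * (2 * δ / (δ + 2)) =
      (lam * n * δ ^ 2 - 2 * δ ^ 2 * n ^ 2) / (δ + 2) := by field_simp; ring
  have h4 : (lam * n * δ ^ 2 - 2 * δ ^ 2 * n ^ 2) / (δ + 2) ≤ -(δ ^ 2 / 2 * n) := by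
    rw [div_le_iff₀ (by positivity)]
    have h5 : lam * n * δ ^ 2 ≤ n / 2 * n * δ ^ 2 := by gcongr
    have h6 : δ ^ 2 / 2 * n * (δ + 2) ≤ δ ^ 2 / 2 * (n * n) * 3 := by
      have : (n : ℝ) ≤ n * n := by nlinarith
      have : δ + 2 ≤ 3 := by linarith
      gcongr
    nlinarith
  linarith

theorem tendsto_measureReal_of_subset {p : ℕ → I}
    {E F : ∀ n : ℕ, Set (Fin n × Fin n → Bool)} (hEF : ∀ᶠ n in atTop, E n ⊆ F n)
    (hF : Tendsto (fun n => (randomBoolFun n (p n)).real (F n)) atTop (𝓝 0)) :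
    Tendsto (fun n => (randomBoolFun n (p n)).real (E n)) atTop (𝓝 0) :=
  squeeze_zero' (Eventually.of_forall fun _ => measureReal_nonneg)
    (hEF.mono fun _ h => measureReal_mono h) hF

theorem tendsto_measureReal_union {p : ℕ → I}
    {E F : ∀ n : ℕ, Set (Fin n × Fin n → Bool)}
    (hE : Tendsto (fun n => (randomBoolFun n (p n)).real (E n)) atTop (𝓝 0))
    (hF : Tendsto (fun n => (randomBoolFun n (p n)).real (F n)) atTop (𝓝 0)) :
    Tendsto (fun n => (randomBoolFun n (p n)).real (E n ∪ F n)) atTop (𝓝 0) :=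
  squeeze_zero (fun _ => measureReal_nonneg) (fun _ => measureReal_union_le _ _)
    (by simpa using hE.add hF)

theorem aas_and {p : ℕ → I} {E F : ∀ n : ℕ, (Fin n × Fin n → Bool) → Prop}
    (hE : Tendsto (fun n => (randomBoolFun n (p n)).real {f | ¬ E n f}) atTop (𝓝 0))
    (hF : Tendsto (fun n => (randomBoolFun n (p n)).real {f | ¬ F n f}) atTop (𝓝 0)) :
    AAS p fun n f => E n f ∧ F n f :=
  aas_of_tendsto_zero <| tendsto_measureReal_of_subset
    (Eventually.of_forall fun _ _ hf => not_and_or.1 hf) (tendsto_measureReal_union hE hF)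

/-! ### Lower and upper bounds in the asymptotic regimes -/

section Asymptotics

variable {p : ℕ → I} {lam : ℕ → ℝ}

theorem tendsto_lower_bound_fails
    (hlam : ∀ᶠ n : ℕ in atTop, (p n : ℝ) = 1 - lam n / n)
    (hp : ∀ᶠ n : ℕ in atTop, (1 / 2 : ℝ) < p n) (hinf : Tendsto lam atTop atTop)
    {η : ℝ} (hη : 0 < η) :
    Tendsto (fun n => (randomBoolFun n (p n)).real
      {f | ¬ ENNReal.ofReal ((1 - η) * ((p n : ℝ) * Real.exp 1 * lam n)) ≤ fracCoverNumber f})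
      atTop (𝓝 0) := by
  classical
  -- Ensures (1-η)(1+δ) ≤ 1-2δ. The loss 1-2δ comes from p - δ ≥ p(1-2δ), valid because p > 1/2.
  set δ := min (η / 3) (1 / 3) with hδ
  have hδ0 : 0 < δ := by positivity
  have hδ1 : δ ≤ 1 / 3 := min_le_right _ _
  have hδη : 3 * δ ≤ η := by linarith [min_le_left (η / 3) (1 / 3)]
  obtain ⟨κ, hκ, L, hrect⟩ := exists_measureReal_rectangle_le hδ0 (by linarith)
  have hexp : ∀ c : ℝ, 0 < c → Tendsto (fun n : ℕ => Real.exp (-(c * n))) atTop (𝓝 0) :=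
    fun c hc => Real.tendsto_exp_neg_atTop_nhds_zero.comp
      (tendsto_natCast_atTop_atTop.const_mul_atTop hc)
  have hbase : ∀ᶠ n : ℕ in atTop, 0 < n ∧ (p n : ℝ) = 1 - lam n / n ∧ (1 / 2 : ℝ) < p n ∧
      max L 1 ≤ lam n ∧ lam n ≤ n / 2 := by
    filter_upwards [eventually_gt_atTop 0, hlam, hp, hinf.eventually_ge_atTop (max L 1)]
      with n hn h1 h2 h3
    refine ⟨hn, h1, h2, h3, ?_⟩
    have hn0 : (0 : ℝ) < n := Nat.cast_pos.2 hn
    have h4 : lam n / n ≤ 1 / 2 := by linarith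
    rw [div_le_iff₀ hn0] at h4
    linarith
  have hZ : Tendsto (fun n => (randomBoolFun n (p n)).real
      {f | (lam n + δ * n) * n ≤ ((Finset.univ.filter fun w => f w = false).card : ℝ)})
      atTop (𝓝 0) :=
    squeeze_zero' (Eventually.of_forall fun _ => measureReal_nonneg)
      (hbase.mono fun n h => measureReal_zeros_ge_add n (p n) h.1 h.2.1 h.2.2.2.2 hδ0
        (by linarith)) (hexp _ (by positivity))
  have hR : Tendsto (fun n => (randomBoolFun n (p n)).real
      {f | ∃ R, IsOneRectangle f R ∧
        (1 + δ) * n ^ 2 / (Real.exp 1 * lam n) < R.ncard}) atTop (𝓝 0) := by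
    refine squeeze_zero' (Eventually.of_forall fun _ => measureReal_nonneg)
      (hbase.mono fun n h => hrect n (p n) (lam n) h.1 ((le_max_left _ _).trans h.2.2.2.1)
        (h.2.2.2.2.trans (by linarith [(Nat.cast_nonneg n : (0 : ℝ) ≤ n)])) h.2.1) ?_
    simpa using (hexp κ hκ).const_mul 2
  refine tendsto_measureReal_of_subset ?_ (tendsto_measureReal_union hZ hR)
  filter_upwards [hbase] with n ⟨hn, hpn, hp2, hL, hl2⟩ f hf
  by_contra hcon
  refine hf ?_
  have hn0 : (0 : ℝ) < n := Nat.cast_pos.2 hn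
  have hl0 : 0 < lam n := lt_of_lt_of_le one_pos ((le_max_right _ _).trans hL)
  have he := Real.exp_pos 1
  obtain ⟨h1, h2⟩ := not_or.1 hcon
  have h1 : ((Finset.univ.filter fun w => f w = false).card : ℝ) < (lam n + δ * n) * n :=
    not_le.1 h1
  have h2 : ∀ R, IsOneRectangle f R → (R.ncard : ℝ) ≤ (1 + δ) * n ^ 2 / (Real.exp 1 * lam n) :=
    fun R hR => not_lt.1 fun h => h2 ⟨R, hR, h⟩
  refine (ENNReal.ofReal_le_ofReal ?_).trans
    (ofReal_ncard_div_le_fracCoverNumber f (by positivity) h2)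
  have hcard : ((supp f).ncard : ℝ) =
      n ^ 2 - ((Finset.univ.filter fun w => f w = false).card : ℝ) := by
    have h3 : supp f = ((Finset.univ.filter fun w => f w = true : Finset (Fin n × Fin n)) :
        Set (Fin n × Fin n)) := by ext w; simp [supp]
    have h4 := Finset.card_filter_add_card_filter_not (s := (Finset.univ : Finset (Fin n × Fin n)))
      (fun w => f w = true)
    simp only [Bool.not_eq_true, Finset.card_univ, Fintype.card_prod, Fintype.card_fin] at h4
    rw [h3, Set.ncard_coe_finset, eq_sub_iff_add_eq, sq]
    exact_mod_cast h4
  have hln : lam n = (1 - p n) * n := by rw [hpn]; field_simp; ring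
  have hsupp : (n : ℝ) ^ 2 * (p n * (1 - 2 * δ)) ≤ (supp f).ncard := by
    rw [hcard]
    have h5 : (lam n + δ * n) * n = (n : ℝ) ^ 2 * (1 - p n + δ) := by rw [hln]; ring
    have h6 : (n : ℝ) ^ 2 * (p n * (1 - 2 * δ)) ≤ (n : ℝ) ^ 2 * (p n - δ) := by
      gcongr; nlinarith
    linarith
  rw [le_div_iff₀ (by positivity)]
  calc (1 - η) * ((p n : ℝ) * Real.exp 1 * lam n) * ((1 + δ) * n ^ 2 / (Real.exp 1 * lam n))
      = (n : ℝ) ^ 2 * (p n * ((1 - η) * (1 + δ))) := by field_simp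
    _ ≤ (n : ℝ) ^ 2 * (p n * (1 - 2 * δ)) := by
        have : (1 - η) * (1 + δ) ≤ 1 - 2 * δ := by nlinarith
        have := (p n).2.1
        gcongr
    _ ≤ _ := hsupp

/-- The exponential of the expression in `h` bounds the probability that some column has at least `z
n` zeros; `θ` is the Chernoff tilt, left free for each regime. -/
theorem tendsto_upper_bound_fails
    (hlam : ∀ᶠ n : ℕ in atTop, (p n : ℝ) = 1 - lam n / n) {z U θ : ℕ → ℝ}
    (hU : ∀ᶠ n in atTop, Real.exp 1 * (z n + 1) ≤ U n) (hθ : ∀ᶠ n in atTop, 1 ≤ θ n)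
    (h : Tendsto (fun n : ℕ => Real.log n + lam n * (θ n - 1) - z n * Real.log (θ n))
      atTop atBot) :
    Tendsto (fun n => (randomBoolFun n (p n)).real
      {f | ¬ fracCoverNumber f ≤ ENNReal.ofReal (U n)}) atTop (𝓝 0) := by
  have hcol : Tendsto (fun n => (randomBoolFun n (p n)).real
      {f | ∃ y, z n ≤ ((Finset.univ.filter fun x => f (x, y) = false).card : ℝ)})
      atTop (𝓝 0) := by
    refine squeeze_zero' (Eventually.of_forall fun _ => measureReal_nonneg) ?_
      (Real.tendsto_exp_atBot.comp h)
    filter_upwards [hlam, hθ, eventually_gt_atTop 0] with n h1 h2 hn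
    have hn0 : (0 : ℝ) < n := Nat.cast_pos.2 hn
    refine (measureReal_column_zeros_ge n (p n) h2 (z n)).trans (le_of_eq ?_)
    have h3 : (n : ℝ) * ((1 - p n) * (θ n - 1)) = lam n * (θ n - 1) := by
      rw [h1]; field_simp; ring
    rw [h3, Function.comp_apply, add_sub_assoc, Real.exp_add, Real.exp_log hn0]
  refine tendsto_measureReal_of_subset ?_ hcol
  filter_upwards [hU, eventually_gt_atTop 0] with n hU hn f hf
  by_contra hcon
  refine hf ?_
  have hlt : ∀ y, ((Finset.univ.filter fun x => f (x, y) = false).card : ℝ) < z n :=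
    fun y => not_le.1 fun h => hcon ⟨y, h⟩
  -- A column exists because n > 0; this gives the sign needed for ⌊z⌋₊ ≤ z.
  have hz : 0 ≤ z n := (Nat.cast_nonneg _).trans (hlt ⟨0, hn⟩).le
  refine (fracCoverNumber_le f ⌊z n⌋₊ fun y => ?_).trans (ENNReal.ofReal_le_ofReal ?_)
  · refine Nat.le_floor ?_
    convert (hlt y).le
  · refine le_trans ?_ hU
    gcongr
    exact Nat.floor_le hz

theorem exists_lower_bound
    (hlam : ∀ᶠ n : ℕ in atTop, (p n : ℝ) = 1 - lam n / n)
    (hp : ∀ᶠ n : ℕ in atTop, (1 / 2 : ℝ) < p n) (hinf : Tendsto lam atTop atTop) :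
    ∃ ε : ℕ → ℝ, Tendsto ε atTop (𝓝 0) ∧ Tendsto (fun n => (randomBoolFun n (p n)).real
      {f | ¬ ENNReal.ofReal ((1 - ε n) * ((p n : ℝ) * Real.exp 1 * lam n)) ≤ fracCoverNumber f})
      atTop (𝓝 0) := by
  refine exists_tendsto_zero_of_forall_pos (P := fun n η => (randomBoolFun n (p n)).real
      {f | ¬ ENNReal.ofReal ((1 - η) * ((p n : ℝ) * Real.exp 1 * lam n)) ≤ fracCoverNumber f})
    ?_ (fun _ _ => measureReal_nonneg) fun η hη => tendsto_lower_bound_fails hlam hp hinf hη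
  filter_upwards [hinf.eventually_ge_atTop 0] with n hn η η' _ hηη'
  refine measureReal_mono fun f hf h => hf (le_trans (ENNReal.ofReal_le_ofReal ?_) h)
  have := (p n).2.1
  gcongr

theorem exists_upper_bound {U : ℕ → ℝ} (hU : ∀ᶠ n in atTop, 0 ≤ U n)
    (h : ∀ η > 0, Tendsto (fun n => (randomBoolFun n (p n)).real
      {f | ¬ fracCoverNumber f ≤ ENNReal.ofReal ((1 + η) * U n)}) atTop (𝓝 0)) :
    ∃ δ : ℕ → ℝ, Tendsto δ atTop (𝓝 0) ∧ Tendsto (fun n => (randomBoolFun n (p n)).real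
      {f | ¬ fracCoverNumber f ≤ ENNReal.ofReal ((1 + δ n) * U n)}) atTop (𝓝 0) := by
  refine exists_tendsto_zero_of_forall_pos (P := fun n η => (randomBoolFun n (p n)).real
      {f | ¬ fracCoverNumber f ≤ ENNReal.ofReal ((1 + η) * U n)})
    ?_ (fun _ _ => measureReal_nonneg) h
  filter_upwards [hU] with n hn η η' _ hηη'
  refine measureReal_mono fun f hf h => hf (h.trans (ENNReal.ofReal_le_ofReal ?_))
  gcongr

theorem tendsto_log_natCast_atTop : Tendsto (fun n : ℕ => Real.log n) atTop atTop :=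
  Real.tendsto_log_atTop.comp tendsto_natCast_atTop_atTop

theorem eventually_nonneg_of_eq_one_sub_div
    (hlam : ∀ᶠ n : ℕ in atTop, (p n : ℝ) = 1 - lam n / n) : ∀ᶠ n : ℕ in atTop, 0 ≤ lam n := by
  filter_upwards [hlam, eventually_gt_atTop 0] with n h hn
  have hn0 : (0 : ℝ) < n := Nat.cast_pos.2 hn
  have h1 : (1 : ℝ) - lam n / n ≤ 1 := h ▸ (p n).2.2
  have h2 : 0 ≤ lam n / n := by linarith
  rwa [le_div_iff₀ hn0, zero_mul] at h2

theorem tendsto_upper_of_log_isLittleO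
    (hlam : ∀ᶠ n : ℕ in atTop, (p n : ℝ) = 1 - lam n / n) (hinf : Tendsto lam atTop atTop)
    (hlog : (fun n : ℕ => Real.log n) =o[atTop] lam) {η : ℝ} (hη : 0 < η) :
    Tendsto (fun n => (randomBoolFun n (p n)).real
      {f | ¬ fracCoverNumber f ≤ ENNReal.ofReal ((1 + η) * (Real.exp 1 * lam n))})
      atTop (𝓝 0) := by
  have hη2 := half_pos hη
  have hc := one_add_mul_log_pos hη2
  set c := (1 + η / 2) * Real.log (1 + η / 2) - η / 2 with hcdef
  -- Half of η goes into the threshold, the other half absorbs the +1 in Z + 1. The Chernoff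
  -- exponent is -cλ, which beats log n ≤ (c/2)λ.
  refine tendsto_upper_bound_fails hlam (z := fun n => (1 + η / 2) * lam n)
    (θ := fun _ => 1 + η / 2) ?_ (Eventually.of_forall fun _ => by linarith) ?_
  · filter_upwards [hinf.eventually_ge_atTop (2 / η)] with n hn
    rw [div_le_iff₀ hη] at hn
    have := Real.exp_pos 1
    calc Real.exp 1 * ((1 + η / 2) * lam n + 1)
        ≤ Real.exp 1 * ((1 + η / 2) * lam n + η / 2 * lam n) := by gcongr; linarith
      _ = _ := by ring
  · refine tendsto_atBot_mono' _ ?_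
      (tendsto_neg_atTop_atBot.comp (hinf.const_mul_atTop (half_pos hc)))
    filter_upwards [hlog.bound (half_pos hc), hinf.eventually_ge_atTop 0] with n hn h0
    have h1 : Real.log n ≤ c / 2 * lam n := by
      rw [Real.norm_of_nonneg h0] at hn
      exact (le_abs_self _).trans hn
    have h2 : lam n * (1 + η / 2 - 1) - (1 + η / 2) * lam n * Real.log (1 + η / 2) =
        -(c * lam n) := by rw [hcdef]; ring
    simp only [Function.comp_apply]
    linarith

theorem tendsto_upper_of_isLittleO_log
    (hlam : ∀ᶠ n : ℕ in atTop, (p n : ℝ) = 1 - lam n / n) (hinf : Tendsto lam atTop atTop)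
    (hlog : lam =o[atTop] fun n : ℕ => Real.log n) {η : ℝ} (hη : 0 < η) :
    Tendsto (fun n => (randomBoolFun n (p n)).real
      {f | ¬ fracCoverNumber f ≤ ENNReal.ofReal ((1 + η) * (Real.exp 1 *
        max (2 * lam n) (Real.log n / Real.log (Real.log n / lam n))))}) atTop (𝓝 0) := by
  have hL := tendsto_log_natCast_atTop
  set r : ℕ → ℝ := fun n => Real.log n / lam n with hr
  have hrinf : Tendsto r atTop atTop := by
    have h1 : Tendsto (fun n : ℕ => lam n / Real.log n) atTop (𝓝[>] 0) := by
      refine tendsto_nhdsWithin_iff.2 ⟨hlog.tendsto_div_nhds_zero, ?_⟩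
      filter_upwards [hinf.eventually_gt_atTop 0, hL.eventually_gt_atTop 0] with n h1 h2
      exact div_pos h1 h2
    refine h1.inv_tendsto_nhdsGT_zero.congr fun n => ?_
    simp [hr]
  set M : ℕ → ℝ := fun n => Real.log n / Real.log (r n) with hM
  -- From log r ≤ r; it serves to make M tend to infinity.
  have hMlam : ∀ᶠ n in atTop, lam n ≤ M n := by
    filter_upwards [hinf.eventually_gt_atTop 0, hL.eventually_gt_atTop 0,
      hrinf.eventually_gt_atTop 1] with n h1 h2 h3
    have h4 : 0 < Real.log (r n) := Real.log_pos h3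
    rw [hM]
    simp only
    rw [le_div_iff₀ h4]
    calc lam n * Real.log (r n) ≤ lam n * r n := by
          gcongr
          exact (Real.log_le_sub_one_of_pos (by linarith)).trans (by linarith)
      _ = Real.log n := by simp only [hr]; field_simp
  have hMinf : Tendsto M atTop atTop := tendsto_atTop_mono' _ hMlam hinf
  set τ := η / 2 with hτ
  have hτ0 : 0 < τ := half_pos hη
  -- The tilt r itself would cost λr = log n, too much. With r^(1-s) the cost is r^(-s) log n =
  -- o(log n), while the gain is still (1 + τ/2) log n, more than the log n of the union bound.
  set s := τ / (2 * (1 + τ)) with hs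
  have hs0 : 0 < s := by positivity
  have hs1 : s ≤ 1 := by rw [hs, div_le_one (by positivity)]; linarith
  have hτs : (1 + τ) * (1 - s) = 1 + τ / 2 := by rw [hs]; field_simp; ring
  refine tendsto_upper_bound_fails hlam (z := fun n => (1 + τ) * M n)
    (θ := fun n => r n ^ (1 - s)) ?_ ?_ ?_
  · filter_upwards [hMinf.eventually_ge_atTop (1 / τ)] with n hn
    have hn' := hn
    rw [div_le_iff₀ hτ0] at hn
    have hM0 : 0 < M n := lt_of_lt_of_le (by positivity) hn'
    calc Real.exp 1 * ((1 + τ) * M n + 1) ≤ Real.exp 1 * ((1 + τ) * M n + M n * τ) := by gcongr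
      _ = (1 + η) * (Real.exp 1 * M n) := by rw [hτ]; ring
      _ ≤ _ := by gcongr; exact le_max_right _ _
  · filter_upwards [hrinf.eventually_ge_atTop 1] with n hn
    exact Real.one_le_rpow hn (by linarith)
  · refine tendsto_atBot_mono' _ ?_
      (tendsto_neg_atTop_atBot.comp (hL.const_mul_atTop (show 0 < τ / 4 by positivity)))
    have hrs : ∀ᶠ n in atTop, r n ^ (-s) ≤ τ / 4 :=
      ((tendsto_rpow_neg_atTop hs0).comp hrinf).eventually (eventually_le_nhds (by positivity))
    filter_upwards [hrs, hinf.eventually_gt_atTop 0, hL.eventually_gt_atTop 0,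
      hrinf.eventually_gt_atTop 1] with n h0 h1 h2 h3
    have h4 : 0 < Real.log (r n) := Real.log_pos h3
    have hr0 : 0 < r n := by linarith
    have h5 : (1 + τ) * M n * Real.log (r n ^ (1 - s)) = (1 + τ / 2) * Real.log n := by
      rw [Real.log_rpow hr0, ← hτs, hM]; field_simp
    have h6 : lam n * (r n ^ (1 - s) - 1) ≤ τ / 4 * Real.log n := by
      calc lam n * (r n ^ (1 - s) - 1) ≤ lam n * r n ^ (1 - s) := by gcongr; linarith
        _ = (lam n * r n) * r n ^ (-s) := by
            rw [mul_assoc, sub_eq_add_neg, Real.rpow_add hr0, Real.rpow_one]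
        _ = Real.log n * r n ^ (-s) := by
            congr 1; simp only [hr]; field_simp
        _ ≤ Real.log n * (τ / 4) := by gcongr
        _ = _ := mul_comm _ _
    rw [h5]
    simp only [Function.comp_apply]
    nlinarith

theorem tendsto_upper_of_le_log
    (hlam : ∀ᶠ n : ℕ in atTop, (p n : ℝ) = 1 - lam n / n) {C : ℝ}
    (hC : ∀ᶠ n : ℕ in atTop, lam n ≤ C * Real.log n) (hC0 : 0 ≤ C) :
    Tendsto (fun n => (randomBoolFun n (p n)).real
      {f | ¬ fracCoverNumber f ≤ ENNReal.ofReal (Real.exp 1 * (2 * C + 3) * Real.log n)})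
      atTop (𝓝 0) := by
  have hL := tendsto_log_natCast_atTop
  -- With tilt e and e - 1 ≤ 2, the exponent is at most (1 + 2C - (2C+2)) log n = -log n.
  refine tendsto_upper_bound_fails hlam (z := fun n => (2 * C + 2) * Real.log n)
    (θ := fun _ => Real.exp 1) ?_
    (Eventually.of_forall fun _ => Real.one_le_exp zero_le_one) ?_
  · filter_upwards [hL.eventually_ge_atTop 1] with n hn
    rw [mul_assoc]
    gcongr
    linarith
  · refine tendsto_atBot_mono' _ ?_ (tendsto_neg_atTop_atBot.comp hL)
    filter_upwards [hC, hL.eventually_ge_atTop 0] with n hn h0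
    have he : Real.exp 1 - 1 ≤ 2 := by linarith [Real.exp_one_lt_d9]
    have he' : 0 ≤ Real.exp 1 - 1 := by linarith [Real.exp_one_gt_d9]
    have h1 : lam n * (Real.exp 1 - 1) ≤ C * Real.log n * 2 :=
      (mul_le_mul_of_nonneg_right hn he').trans (by gcongr)
    rw [Real.log_exp]
    simp only [Function.comp_apply]
    linarith

end Asymptotics

end BoolFun

/-! ### The three regimes assembled -/

theorem theorem4 (p : ℕ → I) (lam : ℕ → ℝ)
    (hlam : ∀ᶠ n : ℕ in atTop, (p n : ℝ) = 1 - lam n / n)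
    (hp : ∀ᶠ n : ℕ in atTop, (1 / 2 : ℝ) < p n) :
    -- (a)
    ((fun n : ℕ => Real.log n) =o[atTop] lam →
      ∃ ε δ : ℕ → ℝ, Tendsto ε atTop (𝓝 0) ∧ Tendsto δ atTop (𝓝 0) ∧
        BoolFun.AAS p fun n f =>
          ENNReal.ofReal ((1 - ε n) * ((p n : ℝ) * Real.exp 1 * lam n))
              ≤ BoolFun.fracCoverNumber f ∧
            BoolFun.fracCoverNumber f ≤ ENNReal.ofReal ((1 + δ n) * (Real.exp 1 * lam n))) ∧
    -- (b)
    (lam =Θ[atTop] (fun n : ℕ => Real.log n) →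
      ∃ c C : ℝ, 0 < c ∧ 0 < C ∧
        BoolFun.AAS p fun n f =>
          ENNReal.ofReal (c * Real.log n) ≤ BoolFun.fracCoverNumber f ∧
            BoolFun.fracCoverNumber f ≤ ENNReal.ofReal (C * Real.log n)) ∧
    -- (c)
    ((fun _ : ℕ => (1 : ℝ)) =o[atTop] lam → lam =o[atTop] (fun n : ℕ => Real.log n) →
      ∃ ε δ : ℕ → ℝ, Tendsto ε atTop (𝓝 0) ∧ Tendsto δ atTop (𝓝 0) ∧
        BoolFun.AAS p fun n f =>
          ENNReal.ofReal ((1 - ε n) * lam n) ≤ BoolFun.fracCoverNumber f ∧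
            BoolFun.fracCoverNumber f ≤
              ENNReal.ofReal ((1 + δ n) * (Real.exp 1 *
                max (2 * lam n) (Real.log n / Real.log (Real.log n / lam n))))) := by
  have hnonneg := BoolFun.eventually_nonneg_of_eq_one_sub_div hlam
  have hL := BoolFun.tendsto_log_natCast_atTop
  have he := Real.exp_pos 1
  have he2 : (2 : ℝ) ≤ Real.exp 1 := by linarith [Real.exp_one_gt_d9]
  have hone : (fun _ : ℕ => (1 : ℝ)) =o[atTop] fun n : ℕ => Real.log n :=
    (Asymptotics.isLittleO_const_left).2 (Or.inr (tendsto_norm_atTop_atTop.comp hL))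
  have hinf_of : (fun _ : ℕ => (1 : ℝ)) =o[atTop] lam → Tendsto lam atTop atTop := by
    intro h
    have h1 : Tendsto (fun n => ‖lam n‖) atTop atTop :=
      ((Asymptotics.isLittleO_const_left).1 h).resolve_left one_ne_zero
    exact h1.congr' (hnonneg.mono fun n hn => Real.norm_of_nonneg hn)
  refine ⟨fun hlog => ?_, fun hlog => ?_, fun h1 hlog => ?_⟩
  · have hinf := hinf_of (hone.trans hlog)
    obtain ⟨ε, hε, hlow⟩ := BoolFun.exists_lower_bound hlam hp hinf
    obtain ⟨δ, hδ, hup⟩ := BoolFun.exists_upper_bound (p := p)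
      (U := fun n => Real.exp 1 * lam n) (hnonneg.mono fun n hn => by positivity)
      fun η hη => BoolFun.tendsto_upper_of_log_isLittleO hlam hinf hlog hη
    exact ⟨ε, δ, hε, hδ, BoolFun.aas_and hlow hup⟩
  · have hinf := hinf_of (hone.trans_isBigO hlog.2)
    obtain ⟨C, hC, hCb⟩ := hlog.1.exists_pos
    obtain ⟨D, hD, hDb⟩ := hlog.2.exists_pos
    have hCb' : ∀ᶠ n : ℕ in atTop, lam n ≤ C * Real.log n := by
      filter_upwards [hCb.bound, hL.eventually_ge_atTop 0] with n hn h0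
      rw [Real.norm_of_nonneg h0] at hn
      exact (le_abs_self _).trans hn
    -- The lower constant combines tolerance 1/2, pe ≥ 1 and log n ≤ Dλ.
    refine ⟨1 / (2 * D), Real.exp 1 * (2 * C + 3), by positivity, by positivity,
      BoolFun.aas_and ?_ (BoolFun.tendsto_upper_of_le_log hlam hCb' hC.le)⟩
    refine BoolFun.tendsto_measureReal_of_subset ?_
      (BoolFun.tendsto_lower_bound_fails hlam hp hinf one_half_pos)
    filter_upwards [hDb.bound, hnonneg, hp] with n hn h0 hpn f hf h
    refine hf (le_trans (ENNReal.ofReal_le_ofReal ?_) h)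
    rw [Real.norm_of_nonneg h0] at hn
    have hn' : Real.log n ≤ D * lam n := (le_abs_self _).trans hn
    have hpe : 1 ≤ (p n : ℝ) * Real.exp 1 := by nlinarith
    calc 1 / (2 * D) * Real.log n ≤ 1 / (2 * D) * (D * lam n) := by gcongr
      _ = (1 - 1 / 2) * (1 * lam n) := by field_simp; norm_num
      _ ≤ _ := by gcongr
  · have hinf := hinf_of h1
    obtain ⟨ε, hε, hlow⟩ := BoolFun.exists_lower_bound hlam hp hinf
    obtain ⟨δ, hδ, hup⟩ := BoolFun.exists_upper_bound (p := p)
      (U := fun n => Real.exp 1 *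
        max (2 * lam n) (Real.log n / Real.log (Real.log n / lam n)))
      (hnonneg.mono fun n hn => mul_nonneg he.le (le_max_of_le_left (by positivity)))
      fun η hη => BoolFun.tendsto_upper_of_isLittleO_log hlam hinf hlog hη
    refine ⟨ε, δ, hε, hδ, BoolFun.aas_and ?_ hup⟩
    refine BoolFun.tendsto_measureReal_of_subset ?_ hlow
    -- The factor pe ≥ 1 is dropped from the lower bound, which needs 1 - ε ≥ 0.
    filter_upwards [hnonneg, hp, hε.eventually (eventually_le_nhds one_pos)]
      with n h0 hpn hεn f hf h
    refine hf (le_trans (ENNReal.ofReal_le_ofReal ?_) h)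
    have hpe : 1 ≤ (p n : ℝ) * Real.exp 1 := by nlinarith
    have hε1 : 0 ≤ 1 - ε n := sub_nonneg.2 hεn
    gcongr
    nlinarith
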